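/- A \emph{Cantor set} is a nonempty compact totally disconnected subset of $\mathbb R$ without isolated points. A \emph{construction} $\mathcal I$ assigns to every finite binary word $w$ (including the empty word) a closed interval $I_w=[a_w,b_w]$, $a_w<b_w$, such that $a_{w0}=a_w$, $b_{w1}=b_w$ and $a_w<b_{w0}<a_{w1}<b_w$; its ratios of dissection are $\frac{b_{wj}-a_{wj}}{b_w-a_w}$ ($j\in\{0,1\}$), and it constructs the set $\bigcap_{n\ge 0}\bigcup_{|w|=n}I_w$. A \emph{ulbd Cantor set} (uniformly lower bounded dissections) is a Cantor set that is constructed by some construction all of whose ratios of dissection are $\ge a$ for some constant $a>0$. A \emph{finite non-singular hyperbolic $C^2$ IFS} consists of maps $\psi_1,\dots,\psi_M$ that are $C^2$ on a closed interval $I\subseteq\mathbb R$ (bounded or not), with $\psi_i(I)\subseteq I$ for all $i$, for which there are constants $\sigma,\delta$ such that $0<\sigma\le|\psi_i'(x)|\le\delta<1$ for all $x\in I$ and all $i$, and whose fixed points in $I$ are not all equal. Its \emph{attractor} is the unique nonempty compact set $K\subseteq I$ with $K=\bigcup_{i=1}^M\psi_i(K)$. \textbf{Proposition.} Let $K$ be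 either a ulbd Cantor set or the attractor of a finite non-singular hyperbolic $C^2$ IFS, and let $0<\alpha<1$. Then there is an integer $n\ge 1$ such that the geometric sum $$K_n=\alpha^{-1}K+\alpha^{-2}K+\dots+\alpha^{-n}K=\Big\{\sum_{i=1}^n\alpha^{-i}x_i : x_1,\dots,x_n\in K\Big\}$$ is a disjoint union of finitely many closed bounded intervals $[a,b]$ with $a<b$. -/

import Mathlib

open Set
open scoped Pointwise

/-- A Cantor set in the real line: a nonempty compact totally disconnected set without isolated
points. -/
def IsCantorSet (K : Set ℝ) : Prop :=
  K.Nonempty ∧ IsCompact K ∧ IsTotallyDisconnected K ∧ Preperfect K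

/-- An iterative construction on the line: to each finite binary word `w` (`false` is the letter 0,
`true` is the letter 1) it attaches a closed interval `I_w = [left w, right w]`, `left w < right w`,
and `I_w` is dissected by removing a nonempty open middle interval: `I_{w0}` is the remaining
left piece and `I_{w1}` the remaining right piece. -/
structure DissectionConstruction where
  left : List Bool → ℝ
  right : List Bool → ℝ
  left_lt_right : ∀ w, left w < right w
  left_zero : ∀ w, left (w ++ [false]) = left w
  right_one : ∀ w, right (w ++ [true]) = right w
  gap : ∀ w, right (w ++ [false]) < left (w ++ [true])

namespace DissectionConstruction

/-- The interval `I_w`. -/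
def interval (𝓘 : DissectionConstruction) (w : List Bool) : Set ℝ :=
  Icc (𝓘.left w) (𝓘.right w)

/-- The ratio of dissection `d(I_{wj}) / d(I_w)`. -/
noncomputable def ratio (𝓘 : DissectionConstruction) (w : List Bool) (j : Bool) : ℝ :=
  (𝓘.right (w ++ [j]) - 𝓘.left (w ++ [j])) / (𝓘.right w - 𝓘.left w)

/-- `C_n`, the union of the intervals attached to the words of length `n`. -/
def level (𝓘 : DissectionConstruction) (n : ℕ) : Set ℝ :=
  ⋃ (w : List Bool) (_ : w.length = n), 𝓘.interval w

/-- `C`, the set that is constructed: the intersection of all the `C_n`. -/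
def limitSet (𝓘 : DissectionConstruction) : Set ℝ :=
  ⋂ n : ℕ, 𝓘.level n

/-- Uniformly lower bounded dissections: all the ratios of dissection are at least some `a > 0`. -/
def IsUlbd (𝓘 : DissectionConstruction) : Prop :=
  ∃ a : ℝ, 0 < a ∧ ∀ w j, a ≤ 𝓘.ratio w j

end DissectionConstruction

/-- A ulbd Cantor set: a Cantor set that admits a construction of uniformly lower bounded
dissections. -/
def IsUlbdCantorSet (K : Set ℝ) : Prop :=
  IsCantorSet K ∧ ∃ 𝓘 : DissectionConstruction, 𝓘.IsUlbd ∧ 𝓘.limitSet = K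

/-- A finite non-singular hyperbolic `C²` iterated function system `ψ_1, …, ψ_M` on a closed
interval `I` (bounded or not). Only the restrictions of the maps to `I` matter; the derivative is
the derivative within `I`, that is, one-sided at an end point of `I`. -/
structure IsNonsingularHyperbolicIFS {M : ℕ} (ψ : Fin M → ℝ → ℝ) (I : Set ℝ) : Prop where
  isClosed : IsClosed I
  isInterval : I.OrdConnected
  contDiffOn : ∀ i, ContDiffOn ℝ 2 (ψ i) I
  deriv_bounds : ∃ σ δ : ℝ, 0 < σ ∧ δ < 1 ∧
    ∀ i, ∀ x ∈ I, σ ≤ |derivWithin (ψ i) I x| ∧ |derivWithin (ψ i) I x| ≤ δ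
  mapsTo : ∀ i, MapsTo (ψ i) I I
  two_fixed_points : ∃ i j, ∃ p ∈ I, ∃ q ∈ I, ψ i p = p ∧ ψ j q = q ∧ p ≠ q

/-- `K` is the attractor of the system `ψ` on `I`: the nonempty compact subset of `I` that equals
the closure of the union of its images under the maps. -/
def IsAttractor {M : ℕ} (ψ : Fin M → ℝ → ℝ) (I K : Set ℝ) : Prop :=
  K.Nonempty ∧ IsCompact K ∧ K ⊆ I ∧ K = closure (⋃ i, ψ i '' K)

/-- The set is the union of finitely many pairwise disjoint nondegenerate compact intervals. -/
def IsFiniteDisjointUnionOfClosedIntervals (S : Set ℝ) : Prop :=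
  ∃ (m : ℕ) (a b : Fin m → ℝ), (∀ i, a i < b i) ∧
    (∀ i j, i ≠ j → Disjoint (Icc (a i) (b i)) (Icc (a j) (b j))) ∧
    S = ⋃ i, Icc (a i) (b i)

/-- The geometric sum `K_n = α⁻¹ K + α⁻² K + ⋯ + α⁻ⁿ K` (Minkowski sum of dilates). -/
noncomputable def geometricSum (α : ℝ) (K : Set ℝ) (n : ℕ) : Set ℝ :=
  ∑ i ∈ Finset.Icc 1 n, (α ^ i)⁻¹ • K

/-! Both kinds of set can be cut repeatedly into pieces whose length ratio to the parent lies in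
`[c, δ]`, with `c > 0` and `δ < 1`. Nothing else about `K` matters, and pieces may overlap.

The core is `IsBalanced.mem_sum`: if at least `1 + 1/c` refinable sets have lengths within a factor
`c` of each other, their sum contains the sum of their hulls. Given `x` in the sum of the hulls,
replace a longest set by its leftmost or its rightmost piece. The gap between these two pieces is no
longer than the total length of the other hulls, so one of the two choices keeps `x` in the sum of
the hulls, and balance survives. Iterating shrinks all sets, and compactness puts `x` in the sum.

For `K_n`, each point of `α⁻ⁱ K` lies in a piece of length between `c r` and `r`, where `r` is the
diameter of `K`; this uses `α⁻ⁱ ≥ 1`. Such pieces are balanced, so every point of `K_n` lies in an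
interval of length at least `c r` inside `K_n`. A compact set with this property has finitely many
components, all nondegenerate intervals. The number `n ≥ 1 + 1/c` does not depend on `α`.

The pieces of a ulbd Cantor set are its parts in the intervals `I_w`. Those of an attractor are its
images under compositions of the maps, with ratios controlled by bounded distortion. -/

/-! ### Refinable sets -/

/-- A compact set `P ⊆ ℝ` that can be cut again and again into nondegenerate compact pieces, every
piece being at least `c` times and at most `δ` times as long as the one it is cut from. -/
def IsRefinable (c δ : ℝ) (P : Set ℝ) : Prop :=
  ∃ 𝓕 : Set (Set ℝ), P ∈ 𝓕 ∧ ∀ A ∈ 𝓕, IsCompact A ∧ 0 < Metric.diam A ∧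
    ∀ x ∈ A, ∃ B ∈ 𝓕, x ∈ B ∧ B ⊆ A ∧
      c * Metric.diam A ≤ Metric.diam B ∧ Metric.diam B ≤ δ * Metric.diam A

namespace IsRefinable

variable {c δ : ℝ} {P : Set ℝ}

theorem isCompact (h : IsRefinable c δ P) : IsCompact P := by
  obtain ⟨𝓕, hP, h⟩ := h
  exact (h P hP).1

theorem diam_pos (h : IsRefinable c δ P) : 0 < Metric.diam P := by
  obtain ⟨𝓕, hP, h⟩ := h
  exact (h P hP).2.1

theorem exists_piece (h : IsRefinable c δ P) {x : ℝ} (hx : x ∈ P) :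
    ∃ B, IsRefinable c δ B ∧ x ∈ B ∧ B ⊆ P ∧
      c * Metric.diam P ≤ Metric.diam B ∧ Metric.diam B ≤ δ * Metric.diam P := by
  obtain ⟨𝓕, hP, h⟩ := h
  obtain ⟨B, hB, hx, hBP, h1, h2⟩ := (h P hP).2.2 x hx
  exact ⟨B, ⟨𝓕, hB, h⟩, hx, hBP, h1, h2⟩

theorem nonempty (h : IsRefinable c δ P) : P.Nonempty := by
  by_contra hne
  have := h.diam_pos
  simp [not_nonempty_iff_eq_empty.1 hne] at this

theorem diam_eq (h : IsRefinable c δ P) : Metric.diam P = sSup P - sInf P :=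
  Real.diam_eq h.isCompact.isBounded

theorem sInf_mem (h : IsRefinable c δ P) : sInf P ∈ P := h.isCompact.sInf_mem h.nonempty

theorem sSup_mem (h : IsRefinable c δ P) : sSup P ∈ P := h.isCompact.sSup_mem h.nonempty

theorem smul (h : IsRefinable c δ P) {t : ℝ} (ht : 0 < t) : IsRefinable c δ (t • P) := by
  obtain ⟨𝓕, hP, h⟩ := h
  refine ⟨(fun A => t • A) '' 𝓕, mem_image_of_mem _ hP, ?_⟩
  rintro _ ⟨A, hA, rfl⟩
  obtain ⟨h1, h2, h3⟩ := h A hA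
  refine ⟨h1.smul t, ?_, ?_⟩
  · simp only [diam_smul₀, Real.norm_eq_abs, abs_of_pos ht]
    positivity
  · rintro _ ⟨x, hx, rfl⟩
    obtain ⟨B, hB, hxB, hBA, h4, h5⟩ := h3 x hx
    refine ⟨t • B, mem_image_of_mem _ hB, smul_mem_smul_set hxB, smul_set_mono hBA, ?_, ?_⟩
    · simp only [diam_smul₀, Real.norm_eq_abs, abs_of_pos ht]
      nlinarith
    · simp only [diam_smul₀, Real.norm_eq_abs, abs_of_pos ht]
      nlinarith

theorem ratio_le (h : IsRefinable c δ P) : c ≤ δ := by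
  obtain ⟨x, hx⟩ := h.nonempty
  obtain ⟨B, -, -, -, h1, h2⟩ := h.exists_piece hx
  exact le_of_mul_le_mul_right (h1.trans h2) h.diam_pos

/-- Every point lies in a piece whose length is comparable to a prescribed small length. -/
theorem exists_piece_of_length (h : IsRefinable c δ P) (hc : 0 < c) (hδ : δ < 1) {x r : ℝ}
    (hx : x ∈ P) (hr : 0 < r) (hrP : r ≤ Metric.diam P) :
    ∃ B, IsRefinable c δ B ∧ x ∈ B ∧ B ⊆ P ∧ c * r ≤ Metric.diam B ∧ Metric.diam B ≤ r := by
  have hδ0 : 0 < δ := hc.trans_le h.ratio_le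
  -- Stop at the first piece of length at most `r`: its parent is longer than `r`, so it has length
  -- at least `c * r`. The exponent `k` bounds the number of cuts still needed.
  have key : ∀ k : ℕ, ∀ A, IsRefinable c δ A → x ∈ A → A ⊆ P → c * r ≤ Metric.diam A →
      δ ^ k * Metric.diam A ≤ r →
      ∃ B, IsRefinable c δ B ∧ x ∈ B ∧ B ⊆ P ∧ c * r ≤ Metric.diam B ∧ Metric.diam B ≤ r := by
    intro k
    induction k with
    | zero => exact fun A hA hxA hAP h1 h2 => ⟨A, hA, hxA, hAP, h1, by simpa using h2⟩
    | succ k ih =>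
      intro A hA hxA hAP h1 h2
      rcases le_or_gt (Metric.diam A) r with h3 | h3
      · exact ⟨A, hA, hxA, hAP, h1, h3⟩
      · obtain ⟨B, hB, hxB, hBA, h4, h5⟩ := hA.exists_piece hxA
        refine ih B hB hxB (hBA.trans hAP) ?_ ?_
        · nlinarith
        · calc δ ^ k * Metric.diam B ≤ δ ^ k * (δ * Metric.diam A) := by gcongr
            _ = δ ^ (k + 1) * Metric.diam A := by ring
            _ ≤ r := h2
  have hP := h.diam_pos
  obtain ⟨k, hk⟩ := exists_pow_lt_of_lt_one (div_pos hr hP) hδ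
  refine key k P h hx subset_rfl ?_ ((lt_div_iff₀ hP).1 hk).le
  nlinarith [h.ratio_le]

end IsRefinable

/-! ### Sums of balanced families -/

theorem isCompact_finset_sum {ι : Type*} (s : Finset ι) (P : ι → Set ℝ)
    (h : ∀ i ∈ s, IsCompact (P i)) : IsCompact (∑ i ∈ s, P i) := by
  classical
  induction s using Finset.induction_on with
  | empty => simp
  | insert i s hi ih =>
    rw [Finset.sum_insert hi]
    exact (h i (by simp)).add (ih fun j hj => h j (by simp [hj]))

/-- The pieces `P i` with `i ∈ s` are refinable, have comparable lengths, and their hulls have a sum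
that contains `x`. -/
structure IsBalanced {ι : Type*} (s : Finset ι) (c δ x : ℝ) (P : ι → Set ℝ) : Prop where
  refinable : ∀ i ∈ s, IsRefinable c δ (P i)
  balanced : ∀ i ∈ s, ∀ j ∈ s, c * Metric.diam (P i) ≤ Metric.diam (P j)
  le : ∑ i ∈ s, sInf (P i) ≤ x
  ge : x ≤ ∑ i ∈ s, sSup (P i)

namespace IsBalanced

variable {ι : Type*} {s : Finset ι} {c δ x : ℝ} {P : ι → Set ℝ}

/-- Replacing one of the longest sets by one of its pieces. -/
theorem update [DecidableEq ι] (h : IsBalanced s c δ x P) (hc : 0 < c) (hδ : δ ≤ 1) {i : ι}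
    (hi : i ∈ s) (hmax : ∀ j ∈ s, Metric.diam (P j) ≤ Metric.diam (P i)) {B : Set ℝ}
    (hB : IsRefinable c δ B) (hcB : c * Metric.diam (P i) ≤ Metric.diam B)
    (hBδ : Metric.diam B ≤ δ * Metric.diam (P i))
    (h1 : sInf B + ∑ j ∈ s.erase i, sInf (P j) ≤ x)
    (h2 : x ≤ sSup B + ∑ j ∈ s.erase i, sSup (P j)) :
    IsBalanced s c δ x (Function.update P i B) := by
  have hpos := (h.refinable i hi).diam_pos
  -- Since `P i` is longest, all lengths after the replacement lie between `c * diam (P i)` and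
  -- `diam (P i)`; this is what preserves balance.
  have hle : ∀ j ∈ s, Metric.diam (Function.update P i B j) ≤ Metric.diam (P i) := by
    intro j hj
    by_cases hji : j = i
    · subst hji
      rw [Function.update_self]
      nlinarith
    · rw [Function.update_of_ne hji]
      exact hmax j hj
  have hge : ∀ j ∈ s, c * Metric.diam (P i) ≤ Metric.diam (Function.update P i B j) := by
    intro j hj
    by_cases hji : j = i
    · subst hji
      rwa [Function.update_self]
    · rw [Function.update_of_ne hji]
      exact h.balanced i hi j hj
  have hsum : ∀ f : Set ℝ → ℝ, ∑ j ∈ s, f (Function.update P i B j) =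
      f B + ∑ j ∈ s.erase i, f (P j) := by
    intro f
    rw [← Finset.add_sum_erase s _ hi, Function.update_self]
    congr 1
    refine Finset.sum_congr rfl fun j hj => ?_
    rw [Function.update_of_ne (Finset.ne_of_mem_erase hj)]
  refine ⟨fun j hj => ?_, fun j hj k hk => ?_, by rwa [hsum], by rwa [hsum]⟩
  · by_cases hji : j = i
    · subst hji
      rwa [Function.update_self]
    · rw [Function.update_of_ne hji]
      exact h.refinable j hj
  · exact (mul_le_mul_of_nonneg_left (hle j hj) hc.le).trans (hge k hk)

/-- The product of the lengths measures progress: one cut shortens one set only, so the maximal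
length need not drop, but the product drops by the factor `δ`. -/
theorem exists_refinement (h : IsBalanced s c δ x P) (hc : 0 < c) (hδ : δ ≤ 1)
    (hs : 1 + 1 / c ≤ s.card) :
    ∃ Q, IsBalanced s c δ x Q ∧ (∀ i ∈ s, Q i ⊆ P i) ∧
      ∏ i ∈ s, Metric.diam (Q i) ≤ δ * ∏ i ∈ s, Metric.diam (P i) := by
  classical
  have hs0 : s.Nonempty := by
    rw [← Finset.card_pos, ← Nat.cast_pos (α := ℝ)]
    exact lt_of_lt_of_le (by positivity) hs
  obtain ⟨i, hi, hmax⟩ := s.exists_max_image (fun j => Metric.diam (P j)) hs0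
  have hPi := h.refinable i hi
  have key : ∀ B, IsRefinable c δ B → B ⊆ P i → c * Metric.diam (P i) ≤ Metric.diam B →
      Metric.diam B ≤ δ * Metric.diam (P i) →
      sInf B + ∑ j ∈ s.erase i, sInf (P j) ≤ x → x ≤ sSup B + ∑ j ∈ s.erase i, sSup (P j) →
      ∃ Q, IsBalanced s c δ x Q ∧ (∀ i ∈ s, Q i ⊆ P i) ∧
      ∏ i ∈ s, Metric.diam (Q i) ≤ δ * ∏ i ∈ s, Metric.diam (P i) := by
    intro B hB hBP h1 h2 h3 h4
    refine ⟨_, h.update hc hδ hi hmax hB h1 h2 h3 h4, fun j hj => ?_, ?_⟩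
    · by_cases hji : j = i
      · subst hji
        rwa [Function.update_self]
      · rw [Function.update_of_ne hji]
    · rw [← Finset.mul_prod_erase s _ hi, ← Finset.mul_prod_erase s (fun j => Metric.diam (P j)) hi,
        Function.update_self, ← mul_assoc]
      have : ∏ j ∈ s.erase i, Metric.diam (Function.update P i B j) =
          ∏ j ∈ s.erase i, Metric.diam (P j) := Finset.prod_congr rfl fun j hj => by
        rw [Function.update_of_ne (Finset.ne_of_mem_erase hj)]
      rw [this]
      exact mul_le_mul_of_nonneg_right h2 (Finset.prod_nonneg fun _ _ => Metric.diam_nonneg)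
  obtain ⟨B₀, hB₀, hm₀, hs₀, hl₀, hu₀⟩ := hPi.exists_piece hPi.sInf_mem
  obtain ⟨B₁, hB₁, hm₁, hs₁, hl₁, hu₁⟩ := hPi.exists_piece hPi.sSup_mem
  have hinf : sInf B₀ ≤ sInf (P i) := csInf_le hB₀.isCompact.bddBelow hm₀
  have hsup : sSup (P i) ≤ sSup B₁ := le_csSup hB₁.isCompact.bddAbove hm₁
  have hinf₀ : sInf (P i) ≤ sSup B₀ := le_csSup hB₀.isCompact.bddAbove hm₀
  have hsup₁ : sInf B₁ ≤ sSup (P i) := csInf_le hB₁.isCompact.bddBelow hm₁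
  have hl := h.le
  have hg := h.ge
  rw [← Finset.add_sum_erase s _ hi] at hl hg
  -- The left piece keeps the lower end of the sum of hulls, the right piece the upper end. If `x`
  -- is too large for the left piece, it is large enough for the right one.
  rcases le_or_gt x (sSup B₀ + ∑ j ∈ s.erase i, sSup (P j)) with hx | hx
  · exact key B₀ hB₀ hs₀ hl₀ hu₀ (by linarith) hx
  · refine key B₁ hB₁ hs₁ hl₁ hu₁ ?_ (by linarith)
    -- At least `1 / c` other sets remain, each of length at least `c * diam (P i)`, so their hulls
    -- bridge any gap inside `P i`.
    have hrest : Metric.diam (P i) ≤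
        ∑ j ∈ s.erase i, sSup (P j) - ∑ j ∈ s.erase i, sInf (P j) := by
      rw [← Finset.sum_sub_distrib]
      calc Metric.diam (P i) = (1 / c) * (c * Metric.diam (P i)) := by field_simp
        _ ≤ ((s.erase i).card : ℝ) * (c * Metric.diam (P i)) := by
            have := hPi.diam_pos
            gcongr
            rw [Finset.card_erase_of_mem hi, Nat.cast_sub hs0.card_pos]
            push_cast
            linarith
        _ = ∑ j ∈ s.erase i, c * Metric.diam (P i) := by simp
        _ ≤ _ := Finset.sum_le_sum fun j hj => by
            rw [← (h.refinable j (Finset.mem_of_mem_erase hj)).diam_eq]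
            exact h.balanced i hi j (Finset.mem_of_mem_erase hj)
    have := hPi.diam_eq
    linarith

theorem exists_small (h : IsBalanced s c δ x P) (hc : 0 < c) (hδ : δ < 1)
    (hs : 1 + 1 / c ≤ s.card) {ε : ℝ} (hε : 0 < ε) :
    ∃ Q, IsBalanced s c δ x Q ∧ (∀ i ∈ s, Q i ⊆ P i) ∧ ∀ i ∈ s, Metric.diam (Q i) ≤ ε := by
  have hs0 : s.Nonempty := by
    rw [← Finset.card_pos, ← Nat.cast_pos (α := ℝ)]
    exact lt_of_lt_of_le (by positivity) hs
  have hδ0 : 0 < δ := by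
    obtain ⟨i, hi⟩ := hs0
    exact hc.trans_le (h.refinable i hi).ratio_le
  have key : ∀ k : ℕ, ∃ Q, IsBalanced s c δ x Q ∧ (∀ i ∈ s, Q i ⊆ P i) ∧
      ∏ i ∈ s, Metric.diam (Q i) ≤ δ ^ k * ∏ i ∈ s, Metric.diam (P i) := by
    intro k
    induction k with
    | zero => exact ⟨P, h, fun _ _ => subset_rfl, by simp⟩
    | succ k ih =>
      obtain ⟨Q, hQ, hQP, hQk⟩ := ih
      obtain ⟨R, hR, hRQ, hRk⟩ := hQ.exists_refinement hc hδ.le hs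
      refine ⟨R, hR, fun i hi => (hRQ i hi).trans (hQP i hi), hRk.trans ?_⟩
      rw [pow_succ', mul_assoc]
      gcongr
  have hprod : 0 < ∏ i ∈ s, Metric.diam (P i) :=
    Finset.prod_pos fun i hi => (h.refinable i hi).diam_pos
  obtain ⟨k, hk⟩ := exists_pow_lt_of_lt_one
    (div_pos (pow_pos (mul_pos hc hε) s.card) hprod) hδ
  rw [lt_div_iff₀ hprod] at hk
  obtain ⟨Q, hQ, hQP, hQk⟩ := key k
  refine ⟨Q, hQ, hQP, fun i hi => ?_⟩
  -- By balance a small product forces every single factor to be small.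
  have h1 : (c * Metric.diam (Q i)) ^ s.card ≤ ∏ j ∈ s, Metric.diam (Q j) := by
    rw [← Finset.prod_const]
    exact Finset.prod_le_prod (fun _ _ => mul_nonneg hc.le Metric.diam_nonneg)
      fun j hj => hQ.balanced i hi j hj
  have h2 := lt_of_pow_lt_pow_left₀ _ (mul_nonneg hc.le hε.le) (h1.trans_lt (hQk.trans_lt hk))
  exact (lt_of_mul_lt_mul_left h2 hc.le).le

/-- The sum of sufficiently many refinable sets of comparable lengths contains the sum of their
hulls. -/
theorem mem_sum (h : IsBalanced s c δ x P) (hc : 0 < c) (hδ : δ < 1)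
    (hs : 1 + 1 / c ≤ s.card) : x ∈ ∑ i ∈ s, P i := by
  have hcl : IsClosed (∑ i ∈ s, P i) :=
    (isCompact_finset_sum s P fun i hi => (h.refinable i hi).isCompact).isClosed
  rw [← hcl.closure_eq, Metric.mem_closure_iff]
  intro ε hε
  have hcard : (0 : ℝ) < s.card := lt_of_lt_of_le (by positivity) hs
  obtain ⟨Q, hQ, hQP, hQε⟩ := h.exists_small hc hδ hs (ε := ε / 2 / s.card) (by positivity)
  refine ⟨∑ i ∈ s, sInf (Q i), Set.finsetSum_mem_finsetSum s _ _ fun i hi =>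
    hQP i hi (hQ.refinable i hi).sInf_mem, ?_⟩
  have h1 : ∑ i ∈ s, sSup (Q i) - ∑ i ∈ s, sInf (Q i) ≤ ε / 2 := by
    rw [← Finset.sum_sub_distrib]
    calc _ ≤ ∑ i ∈ s, ε / 2 / s.card := Finset.sum_le_sum fun i hi => by
            rw [← (hQ.refinable i hi).diam_eq]
            exact hQε i hi
      _ = ε / 2 := by
        rw [Finset.sum_const, nsmul_eq_mul]
        field_simp
  have := hQ.le
  have := hQ.ge
  rw [Real.dist_eq, abs_of_nonneg (by linarith)]
  linarith

end IsBalanced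

/-! ### From local intervals to finite unions of intervals -/

/-- A compact set each of whose points lies in an interval of length at least `ε` contained in the
set is a finite disjoint union of nondegenerate compact intervals. -/
theorem isFiniteDisjointUnionOfClosedIntervals_of_intervals {S : Set ℝ} (hS : IsCompact S)
    {ε : ℝ} (hε : 0 < ε)
    (h : ∀ x ∈ S, ∃ u v : ℝ, u + ε ≤ v ∧ x ∈ Icc u v ∧ Icc u v ⊆ S) :
    IsFiniteDisjointUnionOfClosedIntervals S := by
  have hcomp : ∀ x ∈ S, ∃ u v : ℝ, u + ε ≤ v ∧ connectedComponentIn S x = Icc u v := by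
    intro x hx
    have hcl : IsClosed (connectedComponentIn S x) := by
      refine isClosed_of_closure_subset ?_
      exact isPreconnected_connectedComponentIn.closure.subset_connectedComponentIn
        (subset_closure (mem_connectedComponentIn hx))
        (closure_minimal (connectedComponentIn_subset S x) hS.isClosed)
    have heq := eq_Icc_of_connected_compact (isConnected_connectedComponentIn_iff.2 hx)
      (hS.of_isClosed_subset hcl (connectedComponentIn_subset S x))
    refine ⟨_, _, ?_, heq⟩
    obtain ⟨u, v, huv, hxuv, hsub⟩ := h x hx
    have hle : u ≤ v := by linarith
    have h1 : Icc u v ⊆ connectedComponentIn S x :=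
      isPreconnected_Icc.subset_connectedComponentIn hxuv hsub
    rw [heq, Icc_subset_Icc_iff hle] at h1
    linarith [h1.1, h1.2]
  let T : Set (Set ℝ) := connectedComponentIn S '' S
  have hT : ∀ A ∈ T, ∃ u v : ℝ, u + ε ≤ v ∧ A = Icc u v := by
    rintro _ ⟨x, hx, rfl⟩
    exact hcomp x hx
  have hdisj : ∀ A ∈ T, ∀ B ∈ T, A ≠ B → Disjoint A B := by
    rintro _ ⟨x, hx, rfl⟩ _ ⟨y, hy, rfl⟩ hne
    refine disjoint_left.2 fun z hzx hzy => hne ?_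
    rw [connectedComponentIn_eq hzx, connectedComponentIn_eq hzy]
  have hsub : ∀ A ∈ T, A ⊆ S := by
    rintro _ ⟨x, hx, rfl⟩
    exact connectedComponentIn_subset S x
  have hfin : Finite T := by
    -- The components are disjoint, of measure at least `ε`, in a set of finite measure.
    have hμ := MeasureTheory.Measure.finite_const_le_meas_of_disjoint_iUnion
      (MeasureTheory.volume : MeasureTheory.Measure ℝ) (ε := ENNReal.ofReal ε)
      (ENNReal.ofReal_pos.2 hε) (As := fun A : T => (A : Set ℝ))
      (fun A => by
        obtain ⟨u, v, -, hA⟩ := hT A A.2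
        simp only [hA, measurableSet_Icc])
      (fun A B hAB => hdisj A A.2 B B.2 (Subtype.coe_injective.ne hAB))
      (ne_top_of_le_ne_top hS.measure_lt_top.ne
        (MeasureTheory.measure_mono (iUnion_subset fun A => hsub A A.2)))
    refine finite_univ_iff.1 (hμ.subset fun A _ => ?_)
    obtain ⟨u, v, huv, hA⟩ := hT A A.2
    simp only [mem_ofPred_eq, hA, Real.volume_Icc]
    exact ENNReal.ofReal_le_ofReal (by linarith)
  choose u v huv hA using fun A : T => hT A A.2
  obtain ⟨m, ⟨e⟩⟩ := Finite.exists_equiv_fin T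
  refine ⟨m, fun i => u (e.symm i), fun i => v (e.symm i), fun i => by linarith [huv (e.symm i)],
    fun i j hij => ?_, ?_⟩
  · rw [← hA, ← hA]
    exact hdisj _ (e.symm i).2 _ (e.symm j).2
      (Subtype.coe_injective.ne (e.symm.injective.ne hij))
  · ext x
    simp only [mem_iUnion, ← hA]
    constructor
    · exact fun hx => ⟨e ⟨_, mem_image_of_mem _ hx⟩, by
        simpa using mem_connectedComponentIn hx⟩
    · rintro ⟨i, hi⟩
      exact hsub _ (e.symm i).2 hi

/-- Geometric sums of a refinable set with sufficiently many terms. -/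
theorem IsRefinable.exists_geometricSum {c δ : ℝ} {K : Set ℝ} (hK : IsRefinable c δ K)
    (hc : 0 < c) (hδ : δ < 1) {α : ℝ} (hα0 : 0 < α) (hα1 : α < 1) :
    ∃ n : ℕ, 1 ≤ n ∧ IsFiniteDisjointUnionOfClosedIntervals (geometricSum α K n) := by
  obtain ⟨n, hn⟩ := exists_nat_ge (1 + 1 / c)
  have hn1 : 1 ≤ n := by
    have : (0 : ℝ) < n := lt_of_lt_of_le (by positivity) hn
    exact_mod_cast this
  have hr := hK.diam_pos
  have hP : ∀ i : ℕ, IsRefinable c δ ((α ^ i)⁻¹ • K) := fun i => hK.smul (by positivity)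
  have hPr : ∀ i : ℕ, Metric.diam K ≤ Metric.diam ((α ^ i)⁻¹ • K) := by
    intro i
    rw [diam_smul₀, Real.norm_eq_abs, abs_of_pos (by positivity)]
    exact le_mul_of_one_le_left hr.le
      ((one_le_inv₀ (by positivity)).2 (pow_le_one₀ hα0.le hα1.le))
  refine ⟨n, hn1, isFiniteDisjointUnionOfClosedIntervals_of_intervals
    (isCompact_finset_sum _ _ fun i _ => (hP i).isCompact) (mul_pos hc hr) fun x hx => ?_⟩
  obtain ⟨g, hg, rfl⟩ := (Set.mem_finsetSum _ _ _).1 hx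
  have hex : ∀ i : ℕ, ∃ B, i ∈ Finset.Icc 1 n → IsRefinable c δ B ∧ g i ∈ B ∧
      B ⊆ (α ^ i)⁻¹ • K ∧ c * Metric.diam K ≤ Metric.diam B ∧ Metric.diam B ≤ Metric.diam K := by
    intro i
    by_cases hi : i ∈ Finset.Icc 1 n
    · obtain ⟨B, hB⟩ := (hP i).exists_piece_of_length hc hδ (hg hi) hr (hPr i)
      exact ⟨B, fun _ => hB⟩
    · exact ⟨∅, fun h => (hi h).elim⟩
  choose B hB using hex
  refine ⟨∑ i ∈ Finset.Icc 1 n, sInf (B i), ∑ i ∈ Finset.Icc 1 n, sSup (B i), ?_, ⟨?_, ?_⟩, ?_⟩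
  · rw [← le_sub_iff_add_le', ← Finset.sum_sub_distrib]
    have h1 : 1 ∈ Finset.Icc 1 n := by simp [hn1]
    calc c * Metric.diam K ≤ Metric.diam (B 1) := (hB 1 h1).2.2.2.1
      _ = sSup (B 1) - sInf (B 1) := (hB 1 h1).1.diam_eq
      _ ≤ _ := Finset.single_le_sum (f := fun i => sSup (B i) - sInf (B i)) (fun i hi => by
          simp only [← (hB i hi).1.diam_eq]
          exact Metric.diam_nonneg) h1
  · exact Finset.sum_le_sum fun i hi => csInf_le (hB i hi).1.isCompact.bddBelow (hB i hi).2.1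
  · exact Finset.sum_le_sum fun i hi => le_csSup (hB i hi).1.isCompact.bddAbove (hB i hi).2.1
  · intro y hy
    refine Set.finsetSum_subset_finsetSum _ _ _ (fun i hi => (hB i hi).2.2.1)
      (IsBalanced.mem_sum (c := c) (δ := δ) ⟨fun i hi => (hB i hi).1, fun i hi j hj => ?_, hy.1,
        hy.2⟩ hc hδ (by simpa using hn))
    exact (mul_le_mul_of_nonneg_left (hB i hi).2.2.2.2 hc.le).trans (hB j hj).2.2.2.1

/-! ### Ulbd Cantor sets are refinable -/

namespace DissectionConstruction

variable (𝓘 : DissectionConstruction)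

theorem left_le_left (w : List Bool) (j : Bool) : 𝓘.left w ≤ 𝓘.left (w ++ [j]) := by
  have h0 := 𝓘.left_zero w
  have h1 := 𝓘.gap w
  have h2 := 𝓘.left_lt_right (w ++ [false])
  cases j <;> linarith

theorem right_le_right (w : List Bool) (j : Bool) : 𝓘.right (w ++ [j]) ≤ 𝓘.right w := by
  have h0 := 𝓘.right_one w
  have h1 := 𝓘.gap w
  have h2 := 𝓘.left_lt_right (w ++ [true])
  cases j <;> linarith

theorem interval_append_subset (w v : List Bool) : 𝓘.interval (w ++ v) ⊆ 𝓘.interval w := by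
  induction v using List.reverseRecOn with
  | nil => simp
  | append_singleton v j ih =>
    rw [← List.append_assoc]
    exact (Icc_subset_Icc (𝓘.left_le_left _ j) (𝓘.right_le_right _ j)).trans ih

theorem eq_of_mem_interval {x : ℝ} (w v : List Bool) (hwv : w.length = v.length)
    (hw : x ∈ 𝓘.interval w) (hv : x ∈ 𝓘.interval v) : w = v := by
  induction w using List.reverseRecOn generalizing v with
  | nil => simpa [eq_comm] using hwv
  | append_singleton w j ih =>
    induction v using List.reverseRecOn with
    | nil => simp at hwv
    | append_singleton v k _ =>
      obtain rfl := ih v (by simpa using hwv) (𝓘.interval_append_subset _ _ hw)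
        (𝓘.interval_append_subset _ _ hv)
      have h := 𝓘.gap w
      have h1 := hw.1.trans hv.2
      have h2 := hv.1.trans hw.2
      cases j <;> cases k <;> first | rfl | (exfalso; linarith)

/-- Meant for end points: the left end of `I_w` stays in every interval obtained by appending zeros,
the right end in those obtained by appending ones. Shorter levels are reached through prefixes of
`w`. -/
theorem mem_limitSet_of_mem_interval {x : ℝ} (w : List Bool) (z : Bool)
    (hx : ∀ k, x ∈ 𝓘.interval (w ++ List.replicate k z)) : x ∈ 𝓘.limitSet := by
  refine mem_iInter.2 fun n => mem_iUnion₂.2 ?_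
  rcases le_total n w.length with h | h
  · refine ⟨w.take n, by simp [h], ?_⟩
    have h0 := hx 0
    rw [List.replicate_zero, List.append_nil, ← List.take_append_drop n w] at h0
    exact 𝓘.interval_append_subset _ _ h0
  · exact ⟨_, by simp [h], hx (n - w.length)⟩

theorem left_append_replicate (w : List Bool) (k : ℕ) :
    𝓘.left (w ++ List.replicate k false) = 𝓘.left w := by
  induction k with
  | zero => simp
  | succ k ih => rw [List.replicate_succ', ← List.append_assoc, 𝓘.left_zero, ih]

theorem right_append_replicate (w : List Bool) (k : ℕ) :
    𝓘.right (w ++ List.replicate k true) = 𝓘.right w := by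
  induction k with
  | zero => simp
  | succ k ih => rw [List.replicate_succ', ← List.append_assoc, 𝓘.right_one, ih]

theorem left_mem_limitSet (w : List Bool) : 𝓘.left w ∈ 𝓘.limitSet :=
  𝓘.mem_limitSet_of_mem_interval w false fun k => by
    rw [← 𝓘.left_append_replicate w k]
    exact left_mem_Icc.2 (𝓘.left_lt_right _).le

theorem right_mem_limitSet (w : List Bool) : 𝓘.right w ∈ 𝓘.limitSet :=
  𝓘.mem_limitSet_of_mem_interval w true fun k => by
    rw [← 𝓘.right_append_replicate w k]
    exact right_mem_Icc.2 (𝓘.left_lt_right _).le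

theorem diam_limitSet_inter_interval (w : List Bool) :
    Metric.diam (𝓘.limitSet ∩ 𝓘.interval w) = 𝓘.right w - 𝓘.left w := by
  have hle := (𝓘.left_lt_right w).le
  refine le_antisymm ?_ ?_
  · rw [← Real.diam_Icc hle]
    exact Metric.diam_mono inter_subset_right (Metric.isBounded_Icc _ _)
  · rw [← abs_of_nonneg (sub_nonneg.2 hle), ← Real.dist_eq]
    exact Metric.dist_le_diam_of_mem ((Metric.isBounded_Icc _ _).subset inter_subset_right)
      ⟨𝓘.right_mem_limitSet w, right_mem_Icc.2 hle⟩ ⟨𝓘.left_mem_limitSet w, left_mem_Icc.2 hle⟩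

theorem exists_mem_interval_append {x : ℝ} (w : List Bool) (hx : x ∈ 𝓘.limitSet)
    (hw : x ∈ 𝓘.interval w) : ∃ j, x ∈ 𝓘.interval (w ++ [j]) := by
  obtain ⟨v, hv, hxv⟩ := mem_iUnion₂.1 (mem_iInter.1 hx (w.length + 1))
  induction v using List.reverseRecOn with
  | nil => simp at hv
  | append_singleton v j _ =>
    obtain rfl := 𝓘.eq_of_mem_interval w v (by simpa [eq_comm] using hv) hw
      (𝓘.interval_append_subset _ _ hxv)
    exact ⟨j, hxv⟩

/-- Both ends of `I_w` belong to the limit set, so the piece in `I_w` is as long as `I_w`. The upper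
ratio `1 - a` holds because the sibling interval takes at least the fraction `a`. -/
theorem isRefinable_limitSet (hK : IsCompact 𝓘.limitSet) {a : ℝ} (ha : ∀ w j, a ≤ 𝓘.ratio w j) :
    IsRefinable a (1 - a) 𝓘.limitSet := by
  have ha' : ∀ w j, a * (𝓘.right w - 𝓘.left w) ≤ 𝓘.right (w ++ [j]) - 𝓘.left (w ++ [j]) :=
    fun w j => (le_div_iff₀ (sub_pos.2 (𝓘.left_lt_right w))).1 (ha w j)
  refine ⟨range fun w => 𝓘.limitSet ∩ 𝓘.interval w, ⟨[], ?_⟩, ?_⟩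
  · refine inter_eq_left.2 fun x hx => ?_
    obtain ⟨w, hw, hxw⟩ := mem_iUnion₂.1 (mem_iInter.1 hx 0)
    rwa [List.length_eq_zero_iff.1 hw] at hxw
  · rintro _ ⟨w, rfl⟩
    refine ⟨hK.inter_right isClosed_Icc, ?_, ?_⟩
    · rw [diam_limitSet_inter_interval]
      exact sub_pos.2 (𝓘.left_lt_right w)
    · rintro x ⟨hx, hxw⟩
      obtain ⟨j, hj⟩ := 𝓘.exists_mem_interval_append w hx hxw
      refine ⟨_, ⟨w ++ [j], rfl⟩, ⟨hx, hj⟩,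
        inter_subset_inter_right _ (𝓘.interval_append_subset _ _), ?_, ?_⟩
      · simp only [diam_limitSet_inter_interval]
        exact ha' w j
      · simp only [diam_limitSet_inter_interval]
        have h0 := ha' w false
        have h1 := ha' w true
        have h2 := 𝓘.left_zero w
        have h3 := 𝓘.right_one w
        have h4 := 𝓘.gap w
        cases j <;> linarith

end DissectionConstruction

/-! ### Bounded distortion -/

theorem exists_abs_sub_eq_abs_derivWithin_mul {I : Set ℝ} (hI : I.OrdConnected) {φ : ℝ → ℝ}
    (hφ : DifferentiableOn ℝ φ I) {x y : ℝ} (hx : x ∈ I) (hy : y ∈ I) :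
    ∃ ξ ∈ uIcc x y, |φ x - φ y| = |derivWithin φ I ξ| * |x - y| := by
  wlog hxy : x ≤ y generalizing x y
  · obtain ⟨ξ, hξ, h⟩ := this hy hx (le_of_not_ge hxy)
    exact ⟨ξ, uIcc_comm x y ▸ hξ, by rw [abs_sub_comm, h, abs_sub_comm y]⟩
  rcases hxy.eq_or_lt with rfl | hlt
  · exact ⟨x, left_mem_uIcc, by simp⟩
  obtain ⟨ξ, hξ, h⟩ := exists_hasDerivAt_eq_slope φ (derivWithin φ I) hlt
    (hφ.continuousOn.mono (hI.out hx hy)) fun z hz =>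
      (hφ z (hI.out hx hy (Ioo_subset_Icc_self hz))).hasDerivWithinAt.hasDerivAt
        (Filter.mem_of_superset (Icc_mem_nhds hz.1 hz.2) (hI.out hx hy))
  refine ⟨ξ, Icc_subset_uIcc (Ioo_subset_Icc_self hξ), ?_⟩
  have hpos := sub_pos.2 hlt
  rw [h, abs_div, abs_sub_comm x y, abs_sub_comm (φ x), div_mul_cancel₀ _ (abs_pos.2 hpos.ne').ne']

/-- The difference `ξ - η` is extremal at corners of the product of the two intervals. -/
theorem abs_sub_le_of_mem_uIcc {x y u v ξ η d : ℝ} (hξ : ξ ∈ uIcc x y) (hη : η ∈ uIcc u v)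
    (h1 : |x - u| ≤ d) (h2 : |x - v| ≤ d) (h3 : |y - u| ≤ d) (h4 : |y - v| ≤ d) :
    |ξ - η| ≤ d := by
  rw [abs_le] at *
  rcases mem_uIcc.1 hξ with h | h <;> rcases mem_uIcc.1 hη with h' | h' <;>
    constructor <;> linarith

/-- A `C²` function has a Lipschitz derivative on compact intervals. -/
theorem exists_lipschitz_derivWithin {I : Set ℝ} (hI : I.OrdConnected) {φ : ℝ → ℝ}
    (hφ : ContDiffOn ℝ 2 φ I) {p q : ℝ} (hpq : p < q) (hp : p ∈ I) (hq : q ∈ I) :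
    ∃ L : ℝ, ∀ ξ ∈ Icc p q, ∀ η ∈ Icc p q,
      |derivWithin φ I ξ - derivWithin φ I η| ≤ L * |ξ - η| := by
  have hsub : Icc p q ⊆ I := hI.out hp hq
  have hu : UniqueDiffOn ℝ I := uniqueDiffOn_convex hI.convex
    ((nonempty_Ioo.2 hpq).mono (by rw [← interior_Icc]; exact interior_mono hsub))
  have h1 : ContDiffOn ℝ 1 (derivWithin φ I) I := hφ.derivWithin hu (by norm_num)
  obtain ⟨L, hL⟩ := isCompact_Icc.exists_bound_of_continuousOn
    ((h1.continuousOn_derivWithin hu le_rfl).mono hsub)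
  refine ⟨L, fun ξ hξ η hη => ?_⟩
  exact (convex_Icc p q).norm_image_sub_le_of_norm_hasDerivWithin_le
    (fun z hz => (h1.differentiableOn one_ne_zero z (hsub hz)).hasDerivWithinAt.mono hsub)
    hL hη hξ

/-- A system of maps of a compact set into itself: they are bi-Lipschitz contractions, the images
cover the set, and every map distorts ratios of distances by little at small scales. -/
structure IsBoundedDistortionSystem {ι : Type*} (ψ : ι → ℝ → ℝ) (K : Set ℝ) (σ δ L : ℝ) :
    Prop where
  isCompact : IsCompact K
  mapsTo : ∀ i, MapsTo (ψ i) K K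
  cover : ∀ x ∈ K, ∃ i, ∃ y ∈ K, ψ i y = x
  lower : ∀ i, ∀ x ∈ K, ∀ y ∈ K, σ * |x - y| ≤ |ψ i x - ψ i y|
  upper : ∀ i, ∀ x ∈ K, ∀ y ∈ K, |ψ i x - ψ i y| ≤ δ * |x - y|
  distortion : ∀ i, ∀ x ∈ K, ∀ y ∈ K, ∀ u ∈ K, ∀ v ∈ K, ∀ d,
    |x - u| ≤ d → |x - v| ≤ d → |y - u| ≤ d → |y - v| ≤ d →
    |ψ i x - ψ i y| * |u - v| ≤ Real.exp (L * d) * (|ψ i u - ψ i v| * |x - y|)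

namespace IsBoundedDistortionSystem

variable {ι : Type*} {ψ : ι → ℝ → ℝ} {K : Set ℝ} {σ δ L : ℝ}

theorem foldr_mem (h : IsBoundedDistortionSystem ψ K σ δ L) (w : List ι) {x : ℝ} (hx : x ∈ K) :
    w.foldr ψ x ∈ K := by
  induction w with
  | nil => exact hx
  | cons i w ih => exact h.mapsTo i ih

theorem foldr_lower (h : IsBoundedDistortionSystem ψ K σ δ L) (hσ : 0 ≤ σ) (w : List ι) {x y : ℝ}
    (hx : x ∈ K) (hy : y ∈ K) :
    σ ^ w.length * |x - y| ≤ |w.foldr ψ x - w.foldr ψ y| := by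
  induction w with
  | nil => simp
  | cons i w ih =>
    rw [List.length_cons, pow_succ', mul_assoc]
    exact (mul_le_mul_of_nonneg_left ih hσ).trans
      (h.lower i _ (h.foldr_mem w hx) _ (h.foldr_mem w hy))

theorem foldr_upper (h : IsBoundedDistortionSystem ψ K σ δ L) (hδ : 0 ≤ δ) (w : List ι) {x y : ℝ}
    (hx : x ∈ K) (hy : y ∈ K) :
    |w.foldr ψ x - w.foldr ψ y| ≤ δ ^ w.length * |x - y| := by
  induction w with
  | nil => simp
  | cons i w ih =>
    rw [List.length_cons, pow_succ', mul_assoc]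
    exact (h.upper i _ (h.foldr_mem w hx) _ (h.foldr_mem w hy)).trans
      (mul_le_mul_of_nonneg_left ih hδ)

theorem exists_foldr_eq (h : IsBoundedDistortionSystem ψ K σ δ L) (m : ℕ) {x : ℝ} (hx : x ∈ K) :
    ∃ u : List ι, u.length = m ∧ ∃ y ∈ K, u.foldr ψ y = x := by
  induction m generalizing x with
  | zero => exact ⟨[], rfl, x, hx, rfl⟩
  | succ m ih =>
    obtain ⟨i, y, hy, rfl⟩ := h.cover x hx
    obtain ⟨u, rfl, z, hz, rfl⟩ := ih hy
    exact ⟨i :: u, rfl, z, hz, rfl⟩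

theorem continuousOn_foldr (h : IsBoundedDistortionSystem ψ K σ δ L) (hδ : 0 ≤ δ) (w : List ι) :
    ContinuousOn (w.foldr ψ ·) K := by
  have hL : LipschitzOnWith (Real.toNNReal (δ ^ w.length)) (w.foldr ψ ·) K :=
    LipschitzOnWith.of_dist_le_mul fun x hx y hy => by
      rw [Real.coe_toNNReal _ (pow_nonneg hδ _), Real.dist_eq, Real.dist_eq]
      exact h.foldr_upper hδ w hx hy
  exact hL.continuousOn

/-- Bounded distortion for all compositions of the maps. -/
theorem foldr_distortion (h : IsBoundedDistortionSystem ψ K σ δ L) (hσ : 0 < σ) (hδ0 : 0 ≤ δ)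
    (hδ1 : δ < 1) (w : List ι) {x y u v d : ℝ}
    (hx : x ∈ K) (hy : y ∈ K) (hu : u ∈ K) (hv : v ∈ K)
    (h1 : |x - u| ≤ d) (h2 : |x - v| ≤ d) (h3 : |y - u| ≤ d) (h4 : |y - v| ≤ d)
    (hL : 0 ≤ L) :
    |w.foldr ψ x - w.foldr ψ y| * |u - v| ≤
      Real.exp (L / (1 - δ) * d) * (|w.foldr ψ u - w.foldr ψ v| * |x - y|) := by
  induction w using List.reverseRecOn generalizing x y u v d with
  | nil =>
    have hd : 0 ≤ d := (abs_nonneg _).trans h1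
    have hδ' : 0 < 1 - δ := by linarith
    simp only [List.foldr_nil]
    rw [mul_comm |x - y|]
    exact le_mul_of_one_le_left (by positivity) (Real.one_le_exp (by positivity))
  | append_singleton w i ih =>
    simp only [List.foldr_append, List.foldr_cons, List.foldr_nil]
    rcases eq_or_ne x y with rfl | hxy
    · simp
    rcases eq_or_ne u v with rfl | huv
    · simp
    -- The innermost map brings the points within `δ * d` of each other, so the exponents form a
    -- geometric series: `L / (1 - δ) * (δ * d) + L * d = L / (1 - δ) * d`.
    have hup : ∀ {s t}, s ∈ K → t ∈ K → |s - t| ≤ d → |ψ i s - ψ i t| ≤ δ * d :=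
      fun hs ht hst => (h.upper i _ hs _ ht).trans (mul_le_mul_of_nonneg_left hst hδ0)
    have hA := ih (h.mapsTo i hx) (h.mapsTo i hy) (h.mapsTo i hu) (h.mapsTo i hv)
      (hup hx hu h1) (hup hx hv h2) (hup hy hu h3) (hup hy hv h4)
    have hB := h.distortion i x hx y hy u hu v hv d h1 h2 h3 h4
    have hX : 0 < |ψ i x - ψ i y| :=
      (mul_pos hσ (abs_pos.2 (sub_ne_zero.2 hxy))).trans_le (h.lower i x hx y hy)
    have hU : 0 < |ψ i u - ψ i v| :=
      (mul_pos hσ (abs_pos.2 (sub_ne_zero.2 huv))).trans_le (h.lower i u hu v hv)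
    have hexp : Real.exp (L / (1 - δ) * d) =
        Real.exp (L / (1 - δ) * (δ * d)) * Real.exp (L * d) := by
      have hδ' : 1 - δ ≠ 0 := by linarith
      rw [← Real.exp_add]
      congr 1
      field_simp
      ring
    have hAB := mul_le_mul hA hB (by positivity) (by positivity)
    rw [hexp]
    refine le_of_mul_le_mul_right ?_ (mul_pos hX hU)
    refine (Eq.le ?_).trans (hAB.trans (Eq.le ?_)) <;> ring

/-- The pieces are the images of `K` under words, cut by appending `m` innermost letters. One letter
may fail to shorten by a uniform factor below 1 because of the distortion `D`; hence `m` is chosen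
with `D * δ ^ m < 1`. -/
theorem exists_isRefinable (h : IsBoundedDistortionSystem ψ K σ δ L) (hσ : 0 < σ) (hδ0 : 0 < δ)
    (hδ1 : δ < 1) (hL : 0 ≤ L) (hK : 0 < Metric.diam K) :
    ∃ c δ', 0 < c ∧ δ' < 1 ∧ IsRefinable c δ' K := by
  set D := Real.exp (L / (1 - δ) * Metric.diam K) with hD
  have hD0 : 0 < D := Real.exp_pos _
  obtain ⟨m, hm⟩ := exists_pow_lt_of_lt_one (inv_pos.2 hD0) hδ1
  have hdist : ∀ {x y}, x ∈ K → y ∈ K → |x - y| ≤ Metric.diam K := fun hx hy =>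
    Metric.dist_le_diam_of_mem h.isCompact.isBounded hx hy
  have hdistort : ∀ (w : List ι) {x y u v}, x ∈ K → y ∈ K → u ∈ K → v ∈ K →
      |w.foldr ψ x - w.foldr ψ y| * |u - v| ≤ D * (|w.foldr ψ u - w.foldr ψ v| * |x - y|) :=
    fun w x y u v hx hy hu hv => h.foldr_distortion hσ hδ0.le hδ1 w hx hy hu hv
      (hdist hx hu) (hdist hx hv) (hdist hy hu) (hdist hy hv) hL
  have hne : K.Nonempty := by
    by_contra hne
    simp [not_nonempty_iff_eq_empty.1 hne] at hK
  set p := sInf K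
  set q := sSup K
  have hp : p ∈ K := h.isCompact.sInf_mem hne
  have hq : q ∈ K := h.isCompact.sSup_mem hne
  have hpq : |p - q| = Metric.diam K := by
    rw [abs_sub_comm, Real.diam_eq h.isCompact.isBounded]
    exact abs_of_nonneg (sub_nonneg.2 (csInf_le_csSup hne h.isCompact.bddBelow h.isCompact.bddAbove))
  have hcomp : ∀ w : List ι, IsCompact ((w.foldr ψ ·) '' K) := fun w =>
    h.isCompact.image_of_continuousOn (h.continuousOn_foldr hδ0.le w)
  have hdiam : ∀ (w : List ι) {x y}, x ∈ K → y ∈ K →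
      |w.foldr ψ x - w.foldr ψ y| ≤ Metric.diam ((w.foldr ψ ·) '' K) := fun w x y hx hy =>
    Metric.dist_le_diam_of_mem (hcomp w).isBounded (mem_image_of_mem _ hx) (mem_image_of_mem _ hy)
  refine ⟨σ ^ m / D, D * δ ^ m, by positivity, ?_, range fun w : List ι => (w.foldr ψ ·) '' K,
    ⟨[], by simp⟩, ?_⟩
  · calc D * δ ^ m < D * D⁻¹ := by gcongr
      _ = 1 := mul_inv_cancel₀ hD0.ne'
  rintro _ ⟨w, rfl⟩
  refine ⟨hcomp w, ?_, ?_⟩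
  · refine lt_of_lt_of_le ?_ ((h.foldr_lower hσ.le w hp hq).trans (hdiam w hp hq))
    rw [hpq]
    positivity
  rintro _ ⟨x, hx, rfl⟩
  obtain ⟨u, rfl, y, hy, rfl⟩ := h.exists_foldr_eq m hx
  refine ⟨_, ⟨w ++ u, rfl⟩, ⟨y, hy, by simp⟩, ?_, ?_, ?_⟩
  · rintro _ ⟨z, hz, rfl⟩
    exact ⟨u.foldr ψ z, h.foldr_mem u hz, by simp⟩
  -- Any pair `s`, `t` is compared with the images of `p` and `q` under `u`, which are at least `σ ^
  -- m * diam K` apart.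
  · rw [div_mul_eq_mul_div, div_le_iff₀ hD0, mul_comm, ← le_div_iff₀ (by positivity)]
    refine Metric.diam_le_of_forall_dist_le (by positivity) ?_
    rintro _ ⟨s, hs, rfl⟩ _ ⟨t, ht, rfl⟩
    rw [Real.dist_eq, le_div_iff₀ (by positivity)]
    refine le_of_mul_le_mul_right ?_ hK
    calc |w.foldr ψ s - w.foldr ψ t| * σ ^ u.length * Metric.diam K
        = |w.foldr ψ s - w.foldr ψ t| * (σ ^ u.length * |p - q|) := by rw [hpq]; ring
      _ ≤ |w.foldr ψ s - w.foldr ψ t| * |u.foldr ψ p - u.foldr ψ q| := by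
          gcongr
          exact h.foldr_lower hσ.le u hp hq
      _ ≤ D * (|w.foldr ψ (u.foldr ψ p) - w.foldr ψ (u.foldr ψ q)| * |s - t|) :=
          hdistort w hs ht (h.foldr_mem u hp) (h.foldr_mem u hq)
      _ ≤ D * (Metric.diam (((w ++ u).foldr ψ ·) '' K) * Metric.diam K) := by
          rw [← List.foldr_append, ← List.foldr_append]
          gcongr
          · exact hdiam _ hp hq
          · exact hdist hs ht
      _ = _ := by ring
  · refine Metric.diam_le_of_forall_dist_le (by positivity) ?_
    rintro _ ⟨s, hs, rfl⟩ _ ⟨t, ht, rfl⟩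
    rw [Real.dist_eq]
    simp only [List.foldr_append]
    refine le_of_mul_le_mul_right ?_ hK
    calc |w.foldr ψ (u.foldr ψ s) - w.foldr ψ (u.foldr ψ t)| * Metric.diam K
        = |w.foldr ψ (u.foldr ψ s) - w.foldr ψ (u.foldr ψ t)| * |p - q| := by rw [hpq]
      _ ≤ D * (|w.foldr ψ p - w.foldr ψ q| * |u.foldr ψ s - u.foldr ψ t|) :=
          hdistort w (h.foldr_mem u hs) (h.foldr_mem u ht) hp hq
      _ ≤ D * (Metric.diam ((w.foldr ψ ·) '' K) * (δ ^ u.length * Metric.diam K)) := by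
          gcongr
          · exact hdiam _ hp hq
          · refine (h.foldr_upper hδ0.le u hs ht).trans ?_
            gcongr
            exact hdist hs ht
      _ = _ := by ring

end IsBoundedDistortionSystem

/-! ### Attractors are refinable -/

/-- A fixed point of a contraction lies in every nonempty closed invariant set. -/
theorem fixedPoint_mem_of_mapsTo {K : Set ℝ} (hK : IsClosed K) {k p δ : ℝ} (hk : k ∈ K)
    {φ : ℝ → ℝ} (hφ : MapsTo φ K K) (hδ0 : 0 ≤ δ) (hδ1 : δ < 1)
    (hp : ∀ x ∈ K, |φ x - p| ≤ δ * |x - p|) : p ∈ K := by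
  have hiter : ∀ n : ℕ, φ^[n] k ∈ K ∧ |φ^[n] k - p| ≤ δ ^ n * |k - p| := by
    intro n
    induction n with
    | zero => simpa using hk
    | succ n ih =>
      rw [Function.iterate_succ_apply']
      refine ⟨hφ ih.1, (hp _ ih.1).trans ?_⟩
      rw [pow_succ', mul_assoc]
      exact mul_le_mul_of_nonneg_left ih.2 hδ0
  refine hK.mem_of_tendsto (f := fun n => φ^[n] k) (b := Filter.atTop) ?_
    (Filter.Eventually.of_forall fun n => (hiter n).1)
  rw [tendsto_iff_dist_tendsto_zero]
  refine squeeze_zero (fun _ => dist_nonneg) (fun n => (hiter n).2) ?_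
  simpa using (tendsto_pow_atTop_nhds_zero_of_lt_one hδ0 hδ1).mul_const |k - p|

theorem IsNonsingularHyperbolicIFS.exists_isRefinable {M : ℕ} {ψ : Fin M → ℝ → ℝ} {I K : Set ℝ}
    (h : IsNonsingularHyperbolicIFS ψ I) (hK : IsAttractor ψ I K) :
    ∃ c δ, 0 < c ∧ δ < 1 ∧ IsRefinable c δ K := by
  obtain ⟨⟨k, hk⟩, hcpt, hKI, hKeq⟩ := hK
  obtain ⟨σ, δ, hσ, hδ1, hder⟩ := h.deriv_bounds
  obtain ⟨i₁, i₂, p, hp, q, hq, hfp, hfq, hpq⟩ := h.two_fixed_points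
  have hδ0 : 0 < δ := hσ.trans_le ((hder i₁ p hp).1.trans (hder i₁ p hp).2)
  have hdiff : ∀ i, DifferentiableOn ℝ (ψ i) I := fun i =>
    (h.contDiffOn i).differentiableOn two_ne_zero
  have hsub : ∀ {x y}, x ∈ I → y ∈ I → uIcc x y ⊆ I := fun hx hy => h.isInterval.uIcc_subset hx hy
  have hslope := fun i {x y : ℝ} (hx : x ∈ I) (hy : y ∈ I) =>
    exists_abs_sub_eq_abs_derivWithin_mul h.isInterval (hdiff i) hx hy
  have hlower : ∀ i, ∀ x ∈ I, ∀ y ∈ I, σ * |x - y| ≤ |ψ i x - ψ i y| := by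
    intro i x hx y hy
    obtain ⟨ξ, hξ, heq⟩ := hslope i hx hy
    rw [heq]
    exact mul_le_mul_of_nonneg_right (hder i ξ (hsub hx hy hξ)).1 (abs_nonneg _)
  have hupper : ∀ i, ∀ x ∈ I, ∀ y ∈ I, |ψ i x - ψ i y| ≤ δ * |x - y| := by
    intro i x hx y hy
    obtain ⟨ξ, hξ, heq⟩ := hslope i hx hy
    rw [heq]
    exact mul_le_mul_of_nonneg_right (hder i ξ (hsub hx hy hξ)).2 (abs_nonneg _)
  -- A finite union of compact images is already closed.
  have hKun : K = ⋃ i, ψ i '' K := by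
    have hcl : IsClosed (⋃ i, ψ i '' K) := (isCompact_iUnion fun i =>
      hcpt.image_of_continuousOn ((hdiff i).continuousOn.mono hKI)).isClosed
    rwa [hcl.closure_eq] at hKeq
  have hmaps : ∀ i, MapsTo (ψ i) K K := fun i x hx => by
    rw [hKun]
    exact mem_iUnion.2 ⟨i, mem_image_of_mem _ hx⟩
  have hfix : ∀ i, ∀ z ∈ I, ψ i z = z → z ∈ K := fun i z hz hiz =>
    fixedPoint_mem_of_mapsTo hcpt.isClosed hk (hmaps i) hδ0.le hδ1 fun x hx => by
      simpa only [hiz] using hupper i x (hKI hx) z hz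
  have hpK := hfix i₁ p hp hfp
  have hqK := hfix i₂ q hq hfq
  have hdiam : 0 < Metric.diam K := (abs_pos.2 (sub_ne_zero.2 hpq)).trans_le
    (Metric.dist_le_diam_of_mem hcpt.isBounded hpK hqK)
  have hne : K.Nonempty := ⟨k, hk⟩
  have hlt : sInf K < sSup K := by
    rw [← sub_pos, ← Real.diam_eq hcpt.isBounded]
    exact hdiam
  have hKicc : ∀ {x}, x ∈ K → x ∈ Icc (sInf K) (sSup K) := fun hx =>
    ⟨csInf_le hcpt.bddBelow hx, le_csSup hcpt.bddAbove hx⟩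
  have hKu : ∀ {x y}, x ∈ K → y ∈ K → uIcc x y ⊆ Icc (sInf K) (sSup K) := fun hx hy =>
    ordConnected_Icc.uIcc_subset (hKicc hx) (hKicc hy)
  -- The hull of `K` is compact even if `I` is unbounded, so the derivatives are Lipschitz there.
  choose Λ hΛ using fun i => exists_lipschitz_derivWithin h.isInterval (h.contDiffOn i) hlt
    (hKI (hcpt.sInf_mem hne)) (hKI (hcpt.sSup_mem hne))
  set L := ∑ i, |Λ i| with hL
  have hΛL : ∀ i, Λ i ≤ L := fun i => (le_abs_self _).trans
    (Finset.single_le_sum (f := fun i => |Λ i|) (fun _ _ => abs_nonneg _) (Finset.mem_univ i))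
  have hL0 : 0 ≤ L := Finset.sum_nonneg fun _ _ => abs_nonneg _
  refine IsBoundedDistortionSystem.exists_isRefinable (ψ := ψ) (L := L / σ) ⟨hcpt, hmaps,
    fun x hx => ?_, fun i x hx y hy => hlower i x (hKI hx) y (hKI hy),
    fun i x hx y hy => hupper i x (hKI hx) y (hKI hy), ?_⟩ hσ hδ0 hδ1 (by positivity) hdiam
  · rw [hKun] at hx
    obtain ⟨i, y, hy, rfl⟩ := mem_iUnion.1 hx
    exact ⟨i, y, hy, rfl⟩
  · intro i x hx y hy u hu v hv d h1 h2 h3 h4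
    obtain ⟨ξ, hξ, hξe⟩ := hslope i (hKI hx) (hKI hy)
    obtain ⟨η, hη, hηe⟩ := hslope i (hKI hu) (hKI hv)
    have hd : 0 ≤ d := (abs_nonneg _).trans h1
    have hξη := abs_sub_le_of_mem_uIcc hξ hη h1 h2 h3 h4
    have hση := (hder i η (hsub (hKI hu) (hKI hv) hη)).1
    -- The lower bound `σ` turns the additive error `L * d` into the factor `1 + L / σ * d`, at most
    -- the exponential.
    have hξle : |derivWithin (ψ i) I ξ| ≤ Real.exp (L / σ * d) * |derivWithin (ψ i) I η| :=
      calc |derivWithin (ψ i) I ξ| ≤ |derivWithin (ψ i) I η| +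
            |derivWithin (ψ i) I ξ - derivWithin (ψ i) I η| := by
            linarith [abs_sub_abs_le_abs_sub (derivWithin (ψ i) I ξ) (derivWithin (ψ i) I η)]
        _ ≤ |derivWithin (ψ i) I η| + L * d := by
            gcongr
            exact (hΛ i ξ (hKu hx hy hξ) η (hKu hu hv hη)).trans
              (mul_le_mul (hΛL i) hξη (abs_nonneg _) hL0)
        _ = |derivWithin (ψ i) I η| + L / σ * d * σ := by field_simp
        _ ≤ |derivWithin (ψ i) I η| + L / σ * d * |derivWithin (ψ i) I η| := by gcongr
        _ = (L / σ * d + 1) * |derivWithin (ψ i) I η| := by ring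
        _ ≤ _ := by
            gcongr
            exact Real.add_one_le_exp _
    rw [hξe, hηe]
    calc _ = |derivWithin (ψ i) I ξ| * (|x - y| * |u - v|) := by ring
      _ ≤ Real.exp (L / σ * d) * |derivWithin (ψ i) I η| * (|x - y| * |u - v|) := by gcongr
      _ = _ := by ring

theorem mainTheorem2 (K : Set ℝ)
    (hK : IsUlbdCantorSet K ∨
      ∃ (M : ℕ) (ψ : Fin M → ℝ → ℝ) (I : Set ℝ),
        IsNonsingularHyperbolicIFS ψ I ∧ IsAttractor ψ I K)
    (α : ℝ) (hα0 : 0 < α) (hα1 : α < 1) :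
    ∃ n : ℕ, 1 ≤ n ∧ IsFiniteDisjointUnionOfClosedIntervals (geometricSum α K n) := by
  rcases hK with ⟨⟨-, hcpt, -, -⟩, 𝓘, ⟨a, ha0, ha⟩, rfl⟩ | ⟨M, ψ, I, hψ, hK⟩
  · exact (𝓘.isRefinable_limitSet hcpt ha).exists_geometricSum ha0 (by linarith) hα0 hα1
  · obtain ⟨c, δ, hc, hδ, hKr⟩ := hψ.exists_isRefinable hK
    exact hKr.exists_geometricSum hc hδ hα0 hα1
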